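/- Let $G$ be a (finite or infinite, not necessarily connected) simple planar graph of bounded degree, that is, $G$ can be drawn in the plane without crossings and there is an integer $\Delta$ such that every vertex of $G$ has at most $\Delta$ neighbours. Then the vertex set of $G$, equipped with the shortest-path metric $d_G$ (where $d_G(u,v)=\infty$ if $u,v$ lie in different connected components), has Assouad–Nagata dimension at most $2$. Here a family $\mathcal{U}$ of subsets of a metric space $(X,d)$ is called $D$-bounded if each $U\in\mathcal{U}$ has diameter at most $D$, and $r$-disjoint if $d(a,b)>r$ whenever $a,b$ belong to different elements of $\mathcal{U}$. A function $D_X:\mathbb{R}^+\to\mathbb{R}^+$ is an $n$-dimensional control function for $(X,d)$ if for every $r>0$ there is a cover $\mathcal{U}=\bigcup_{i=1}^{n+1}\mathcal{U}_i$ of $X$ such that each $\mathcal{U}_i$ is $r$-disjoint and $\mathcal{U}$ is $D_X(r)$-bounded; it is a dilation if there is a constant $c>0$ with $D_X(r)\le cr$ for all $r>0$. The Assouad–Nagata dimension of $(X,d)$ is the least integer $n\ge 0$ such that $(X,d)$ has an $n$-dimensional control function which is a dilation (and $\infty$ if there is none). -/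

import Mathlib

open scoped NNReal ENNReal

/-! ### Dimension of (extended) metric spaces -/

/-- Every member of the family `𝒰` has diameter at most `D`. -/
def IsDBounded {X : Type*} [EMetricSpace X] (D : ℝ≥0) (𝒰 : Set (Set X)) : Prop :=
  ∀ U ∈ 𝒰, Metric.ediam U ≤ (D : ℝ≥0∞)

/-- Points in different members of the family `𝒰` are at distance more than `r`. -/
def IsRDisjoint {X : Type*} [EMetricSpace X] (r : ℝ≥0) (𝒰 : Set (Set X)) : Prop :=
  ∀ A ∈ 𝒰, ∀ B ∈ 𝒰, A ≠ B → ∀ a ∈ A, ∀ b ∈ B, (r : ℝ≥0∞) < edist a b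

/-- `D` is an `n`-dimensional control function for `X`: for every `r > 0` there is a cover
`𝒰 0 ∪ ⋯ ∪ 𝒰 n` of `X` by sets of diameter at most `D r`, with each `𝒰 i` being `r`-disjoint. -/
def IsControlFunction (X : Type*) [EMetricSpace X] (n : ℕ) (D : ℝ≥0 → ℝ≥0) : Prop :=
  ∀ r : ℝ≥0, 0 < r → ∃ 𝒰 : Fin (n + 1) → Set (Set X),
    (⋃ i, ⋃₀ 𝒰 i) = Set.univ ∧ ∀ i, IsRDisjoint r (𝒰 i) ∧ IsDBounded (D r) (𝒰 i)

/-- `D` is a dilation: it is bounded by a linear function. -/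
def IsDilation (D : ℝ≥0 → ℝ≥0) : Prop :=
  ∃ c : ℝ≥0, 0 < c ∧ ∀ r : ℝ≥0, 0 < r → D r ≤ c * r

/-- The Assouad–Nagata dimension: the least `n` such that `X` has an `n`-dimensional control
function which is a dilation (and `⊤` if there is none). -/
noncomputable def assouadNagataDim (X : Type*) [EMetricSpace X] : ℕ∞ :=
  ⨅ (n : ℕ) (_ : ∃ D : ℝ≥0 → ℝ≥0, IsControlFunction X n D ∧ IsDilation D), (n : ℕ∞)

namespace SimpleGraph

/-- The shortest-path metric of a graph on its vertex set; vertices in different connected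
components are at infinite distance. -/
@[reducible] noncomputable def pathEMetricSpace {V : Type*} (G : SimpleGraph V) :
    EMetricSpace V where
  edist u v := (G.edist u v : ℝ≥0∞)
  edist_self u := by simp
  edist_comm u v := by rw [G.edist_comm]
  edist_triangle u v w := by
    rw [← ENat.toENNReal_add]
    exact ENat.toENNReal_le.mpr SimpleGraph.edist_triangle
  eq_of_edist_eq_zero {u v} h := by
    simpa using h

/-- The Assouad–Nagata dimension of a graph, viewed as a metric space with its shortest-path
metric. -/
noncomputable def assouadNagataDim {V : Type*} (G : SimpleGraph V) : ℕ∞ :=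
  letI := G.pathEMetricSpace
  _root_.assouadNagataDim V

/-- All vertex degrees are bounded by one natural number. -/
def HasBoundedDegree {V : Type*} (G : SimpleGraph V) : Prop :=
  ∃ Δ : ℕ, ∀ v, (G.neighborSet v).encard ≤ Δ

/-- A drawing of `G` in the Euclidean plane without crossings: vertices are distinct points, the
edge `uv` is a simple arc joining the points of `u` and `v` that contains no other vertex, and two
distinct edges meet only in the points of their common end-vertices. -/
structure PlaneDrawing {V : Type*} (G : SimpleGraph V) where
  point : V → EuclideanSpace ℝ (Fin 2)
  arc : Sym2 V → Set (EuclideanSpace ℝ (Fin 2))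
  point_injective : Function.Injective point
  isArc : ∀ u v, G.Adj u v →
    ∃ γ : _root_.Path (point u) (point v), Function.Injective γ ∧ Set.range γ = arc s(u, v)
  mem_of_point_mem_arc : ∀ e ∈ G.edgeSet, ∀ w, point w ∈ arc e → w ∈ e
  arc_inter_arc : ∀ e ∈ G.edgeSet, ∀ f ∈ G.edgeSet, e ≠ f →
    arc e ∩ arc f ⊆ point '' {w | w ∈ e ∧ w ∈ f}

/-- A graph is planar if it can be drawn in the plane without crossings. -/
def IsPlanar {V : Type*} (G : SimpleGraph V) : Prop :=
  Nonempty G.PlaneDrawing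

end SimpleGraph

/-! The only input from planarity is that there is no K₃,₃ minor (`IsPlanar.not_K33_minor`). It
rests on a parity count of logarithm variations (winding numbers), not on the Jordan curve theorem.

Layer the graph twice. Cut the breadth-first levels of `G` into rings; in a wider annulus H around a
ring, cut the breadth-first levels of H again. A connected piece of the resulting double annulus, at
width `s`, has diameter at most `81 * s` in `G` (`IsPlanar.distLE_of_reachable_doubleAnnulus`).
Otherwise it contains three points far apart, each with a leg descending both in H and in `G`. The
three legs and three hubs (the piece, the ball of H below it, the ball of `G` below the annulus)
then form a K₃,₃ minor.

Colouring the inner layers of a ring by parity therefore bounds the monochromatic chains inside that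
ring. Three colours suffice for all rings: ring `j` uses the colours `j` and `j + 1` modulo 3, so
each colour class mixes at most two adjacent rings, one even and one odd. Odd rings are treated at a
scale exceeding the size of the even chains, and `distLE_of_chain_merge` combines the two. The chain
classes are the required cover. -/

/-! ### Logarithmic variation of nonvanishing paths -/

/-- `α` is the variation over `[0, 1]` of a continuous logarithm of `g`. -/
def HasLogVariation (g : ℝ → ℂ) (α : ℂ) : Prop :=
  ∃ L : ℝ → ℂ, Continuous L ∧ (∀ t, Complex.exp (L t) = g t) ∧ α = L 1 - L 0

/-- A nonvanishing continuous function on a contractible space has a continuous logarithm. -/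
lemma exists_continuous_log {X : Type*} [TopologicalSpace X] [ContractibleSpace X]
    [LocallyPathConnectedSpace X] {g : X → ℂ} (hg : Continuous g) (h0 : ∀ x, g x ≠ 0) :
    ∃ L : X → ℂ, Continuous L ∧ ∀ x, Complex.exp (L x) = g x := by
  obtain ⟨x₀⟩ : Nonempty X := inferInstance
  obtain ⟨F, ⟨-, hF⟩, -⟩ := Complex.isCoveringMapOn_exp.existsUnique_continuousMap_lifts
    ⟨g, hg⟩ (a₀ := x₀) (Complex.exp_log (h0 x₀)) (fun x ↦ h0 x)
  exact ⟨F, F.continuous, fun x ↦ congrFun hF x⟩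

lemma exists_hasLogVariation {g : ℝ → ℂ} (hg : Continuous g) (h0 : ∀ t, g t ≠ 0) :
    ∃ α, HasLogVariation g α := by
  obtain ⟨L, hL, h⟩ := exists_continuous_log hg h0
  exact ⟨_, L, hL, h, rfl⟩

/-- Two logarithms of `g` differ at 0 by a multiple of 2πi. After translation by it they are lifts
of `g` through the exponential with the same starting value, hence equal. -/
lemma HasLogVariation.unique {g : ℝ → ℂ} {α β : ℂ} (hα : HasLogVariation g α)
    (hβ : HasLogVariation g β) : α = β := by
  obtain ⟨L, hL, hLg, rfl⟩ := hα
  obtain ⟨M, hM, hMg, rfl⟩ := hβ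
  have h0 : Complex.exp (L 0) = Complex.exp (M 0) := by rw [hLg, hMg]
  obtain ⟨n, hn⟩ := Complex.exp_eq_exp_iff_exists_int.1 h0
  have hne : ∀ t, g t ≠ 0 := fun t ↦ hLg t ▸ Complex.exp_ne_zero _
  obtain ⟨F, -, hF⟩ := Complex.isCoveringMapOn_exp.existsUnique_continuousMap_lifts
    ⟨g, (Complex.continuous_exp.comp hL).congr hLg⟩ (a₀ := (0 : ℝ))
    (hLg 0) (fun t ↦ hne t)
  have h1 := hF ⟨L, hL⟩ ⟨rfl, funext hLg⟩
  have h2 := hF ⟨fun t ↦ M t + n * (2 * Real.pi * Complex.I), by fun_prop⟩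
    ⟨hn.symm, funext fun t ↦ by
      simpa [hMg t] using
        (Complex.exp_eq_exp_iff_exists_int.2 ⟨n, rfl⟩).trans (hMg t)⟩
  have h3 : L 1 = M 1 + n * (2 * Real.pi * Complex.I) := by
    have := DFunLike.congr_fun (h1.trans h2.symm) (1 : ℝ)
    simpa using this
  rw [h3, hn]; ring

lemma HasLogVariation.neg {g : ℝ → ℂ} {α : ℂ} (hα : HasLogVariation g α) :
    HasLogVariation (fun t ↦ -g t) α := by
  obtain ⟨L, hL, hLg, rfl⟩ := hα
  refine ⟨fun t ↦ L t + Real.pi * Complex.I, by fun_prop, fun t ↦ ?_, by ring⟩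
  rw [Complex.exp_add, hLg, Complex.exp_pi_mul_I]; ring

lemma HasLogVariation.exists_int {g : ℝ → ℂ} {α : ℂ} (hα : HasLogVariation g α) :
    ∃ n : ℤ, α = Complex.log (g 1) - Complex.log (g 0) + n * (2 * Real.pi * Complex.I) := by
  obtain ⟨L, -, hLg, rfl⟩ := hα
  have hne : ∀ t, g t ≠ 0 := fun t ↦ hLg t ▸ Complex.exp_ne_zero _
  obtain ⟨m, hm⟩ := Complex.exp_eq_exp_iff_exists_int.1
    ((hLg 0).trans (Complex.exp_log (hne 0)).symm)
  obtain ⟨n, hn⟩ := Complex.exp_eq_exp_iff_exists_int.1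
    ((hLg 1).trans (Complex.exp_log (hne 1)).symm)
  refine ⟨n - m, ?_⟩
  rw [hm, hn]; push_cast; ring

/-- For two disjoint paths, the difference map has a logarithm on the whole square, so its
variations along the two ways around the square agree. -/
lemma HasLogVariation.add_eq_add {e f : ℝ → ℂ} (he : Continuous e) (hf : Continuous f)
    (hef : ∀ s t, e s ≠ f t) {α₁ α₂ α₃ α₄ : ℂ}
    (h₁ : HasLogVariation (fun t ↦ f t - e 0) α₁) (h₂ : HasLogVariation (fun s ↦ e s - f 1) α₂)
    (h₃ : HasLogVariation (fun t ↦ f t - e 1) α₃) (h₄ : HasLogVariation (fun s ↦ e s - f 0) α₄) :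
    α₁ + α₂ = α₃ + α₄ := by
  obtain ⟨L, hL, hexp⟩ := exists_continuous_log (X := ℝ × ℝ) (g := fun p ↦ f p.2 - e p.1)
    (by fun_prop) (fun p ↦ sub_ne_zero.2 (hef p.1 p.2).symm)
  have k₁ : HasLogVariation (fun t ↦ f t - e 0) (L (0, 1) - L (0, 0)) :=
    ⟨fun t ↦ L (0, t), by fun_prop, fun t ↦ hexp _, rfl⟩
  have k₂ : HasLogVariation (fun s ↦ f 1 - e s) (L (1, 1) - L (0, 1)) :=
    ⟨fun s ↦ L (s, 1), by fun_prop, fun t ↦ hexp _, rfl⟩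
  have k₃ : HasLogVariation (fun t ↦ f t - e 1) (L (1, 1) - L (1, 0)) :=
    ⟨fun t ↦ L (1, t), by fun_prop, fun t ↦ hexp _, rfl⟩
  have k₄ : HasLogVariation (fun s ↦ f 0 - e s) (L (1, 0) - L (0, 0)) :=
    ⟨fun s ↦ L (s, 0), by fun_prop, fun t ↦ hexp _, rfl⟩
  have h₂' := h₂.neg
  have h₄' := h₄.neg
  simp only [neg_sub] at h₂' h₄'
  rw [h₁.unique k₁, h₂'.unique k₂, h₃.unique k₃, h₄'.unique k₄]
  ring

/-- The sign of the difference depends on the branch; only the oddness of the multiple of πi matters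
for the parity count. -/
lemma Complex.exists_log_sub_log_neg {z : ℂ} (hz : z ≠ 0) :
    ∃ m : ℤ, Complex.log z - Complex.log (-z) = (2 * m + 1) * (Real.pi * Complex.I) := by
  have h : Complex.exp (Complex.log z) = Complex.exp (Complex.log (-z) + Real.pi * Complex.I) := by
    rw [Complex.exp_add, Complex.exp_log hz, Complex.exp_log (neg_ne_zero.2 hz),
      Complex.exp_pi_mul_I]
    ring
  obtain ⟨m, hm⟩ := Complex.exp_eq_exp_iff_exists_int.1 h
  exact ⟨m, by rw [hm]; ring⟩

lemma Complex.int_mul_pi_mul_I_eq_zero {n : ℤ} (h : (n : ℂ) * (Real.pi * Complex.I) = 0) :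
    n = 0 := by
  have : (Real.pi * Complex.I : ℂ) ≠ 0 := by simp [Real.pi_ne_zero]
  exact_mod_cast (mul_eq_zero.1 h).resolve_right this

/-! ### Nonplanarity of K₃,₃ -/

/-- The complete bipartite graph `K₃,₃` has no drawing in the plane in which vertex-disjoint edges
are represented by disjoint paths. -/
theorem not_exists_K33_drawing (a b : Fin 3 → ℂ) (g : Fin 3 → Fin 3 → ℝ → ℂ)
    (hg : ∀ i j, Continuous (g i j)) (h0 : ∀ i j, g i j 0 = a i) (h1 : ∀ i j, g i j 1 = b j)
    (hdisj : ∀ i j i' j', i ≠ i' → j ≠ j' → ∀ s t, g i j s ≠ g i' j' t) : False := by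
  have hother : ∀ i : Fin 3, ∃ i', i ≠ i' := by decide
  have hga : ∀ k i j, k ≠ i → ∀ t, g i j t - a k ≠ 0 := by
    intro k i j hk t
    -- `a k` lies on the edge from `a k` to `b j'`, which is vertex-disjoint from the edge at hand.
    obtain ⟨j', hj'⟩ := hother j
    rw [← h0 k j']
    exact sub_ne_zero.2 (hdisj i j k j' hk.symm hj' t 0)
  have hgb : ∀ k i j, k ≠ j → ∀ t, g i j t - b k ≠ 0 := by
    intro k i j hk t
    obtain ⟨i', hi'⟩ := hother i
    rw [← h1 i' k]
    exact sub_ne_zero.2 (hdisj i j i' k hi' hk.symm t 1)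
  have hA : ∀ k i j, ∃ α, k ≠ i → HasLogVariation (fun t ↦ g i j t - a k) α := by
    intro k i j
    by_cases hk : k = i
    -- A dummy value, so that `choose` yields a function of all indices; likewise below.
    · exact ⟨0, fun h ↦ (h hk).elim⟩
    · obtain ⟨α, hα⟩ := exists_hasLogVariation (g := fun t ↦ g i j t - a k)
        ((hg i j).sub continuous_const) (hga k i j hk)
      exact ⟨α, fun _ ↦ hα⟩
  have hB : ∀ k i j, ∃ α, k ≠ j → HasLogVariation (fun t ↦ g i j t - b k) α := by
    intro k i j
    by_cases hk : k = j
    · exact ⟨0, fun h ↦ (h hk).elim⟩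
    · obtain ⟨α, hα⟩ := exists_hasLogVariation (g := fun t ↦ g i j t - b k)
        ((hg i j).sub continuous_const) (hgb k i j hk)
      exact ⟨α, fun _ ↦ hα⟩
  choose αA hαA using hA
  choose αB hαB using hB
  have hNA : ∀ k i j, ∃ n : ℤ, k ≠ i → αA k i j = Complex.log (b j - a k) -
      Complex.log (a i - a k) + n * (2 * Real.pi * Complex.I) := by
    intro k i j
    by_cases hk : k = i
    · exact ⟨0, fun h ↦ (h hk).elim⟩
    · obtain ⟨n, hn⟩ := (hαA k i j hk).exists_int
      exact ⟨n, fun _ ↦ by simpa only [h0, h1] using hn⟩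
  have hNB : ∀ k i j, ∃ n : ℤ, k ≠ j → αB k i j = Complex.log (b j - b k) -
      Complex.log (a i - b k) + n * (2 * Real.pi * Complex.I) := by
    intro k i j
    by_cases hk : k = j
    · exact ⟨0, fun h ↦ (h hk).elim⟩
    · obtain ⟨n, hn⟩ := (hαB k i j hk).exists_int
      exact ⟨n, fun _ ↦ by simpa only [h0, h1] using hn⟩
  choose nA hnA using hNA
  choose nB hnB using hNB
  have hab : ∀ i j, ∃ m : ℤ, Complex.log (b j - a i) - Complex.log (a i - b j) =
      (2 * m + 1) * (Real.pi * Complex.I) := by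
    intro i j
    obtain ⟨i', hi'⟩ := hother i
    have := hga i i' j hi' 1
    rw [h1] at this
    simpa using Complex.exists_log_sub_log_neg this
  have haa : ∀ i i', ∃ m : ℤ, i ≠ i' → Complex.log (a i' - a i) - Complex.log (a i - a i') =
      (2 * m + 1) * (Real.pi * Complex.I) := by
    intro i i'
    by_cases h : i = i'
    · exact ⟨0, fun h' ↦ (h' h).elim⟩
    have := hga i i' 0 h 0
    rw [h0] at this
    obtain ⟨m, hm⟩ := Complex.exists_log_sub_log_neg this
    exact ⟨m, fun _ ↦ by simpa using hm⟩
  have hbb : ∀ i i', ∃ m : ℤ, i ≠ i' → Complex.log (b i' - b i) - Complex.log (b i - b i') =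
      (2 * m + 1) * (Real.pi * Complex.I) := by
    intro i i'
    by_cases h : i = i'
    · exact ⟨0, fun h' ↦ (h' h).elim⟩
    have := hgb i 0 i' h 1
    rw [h1] at this
    obtain ⟨m, hm⟩ := Complex.exists_log_sub_log_neg this
    exact ⟨m, fun _ ↦ by simpa using hm⟩
  choose mab hmab using hab
  choose maa hmaa using haa
  choose mbb hmbb using hbb
  have anti : ∀ j j', j ≠ j' → mbb j j' + mbb j' j + 1 = 0 := by
    intro j j' h
    have e := hmbb j j' h
    have e' := hmbb j' j h.symm
    have : ((2 * (mbb j j' + mbb j' j + 1) : ℤ) : ℂ) * (Real.pi * Complex.I) = 0 := by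
      push_cast; linear_combination -e - e'
    have := Complex.int_mul_pi_mul_I_eq_zero this
    omega
  have rel : ∀ i i' j j', i ≠ i' → j ≠ j' → mab i j' - maa i i' + mbb j' j - mab i' j +
      nA i i' j' + nB j' i j - nB j i' j' - nA i' i j = 0 := by
    intro i i' j j' hi hj
    have key := HasLogVariation.add_eq_add (hg i j) (hg i' j') (hdisj i j i' j' hi hj)
      (by rw [h0]; exact hαA i i' j' hi) (by rw [h1]; exact hαB j' i j hj.symm)
      (by rw [h1]; exact hαB j i' j' hj) (by rw [h0]; exact hαA i' i j hi.symm)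
    rw [hnA _ _ _ hi, hnB _ _ _ hj.symm, hnB _ _ _ hj, hnA _ _ _ hi.symm] at key
    have : ((2 * (mab i j' - maa i i' + mbb j' j - mab i' j +
        nA i i' j' + nB j' i j - nB j i' j' - nA i' i j) : ℤ) : ℂ) * (Real.pi * Complex.I) = 0 := by
      push_cast
      linear_combination key - hmab i j' + hmaa i i' hi - hmbb j' j hj.symm + hmab i' j
    have := Complex.int_mul_pi_mul_I_eq_zero this
    omega
  -- The total winding correction of the edges at `a i` around the other vertices `b k`.
  let t : Fin 3 → ℤ := fun i ↦
    nB 0 i 1 + nB 0 i 2 + nB 1 i 0 + nB 1 i 2 + nB 2 i 0 + nB 2 i 1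
  have odd_sub : ∀ i i', i ≠ i' → (t i - t i') % 2 = 1 := by
    -- Sum `rel` over the six ordered pairs `j ≠ j'`. The terms in `mab`, `maa` and `nA` occur an
    -- even number of times, those in `nB` give `t i - t i'`, and those in `mbb` sum to -3 by
    -- `anti`.
    intro i i' hi
    have r01 := rel i i' 0 1 hi (by decide)
    have r02 := rel i i' 0 2 hi (by decide)
    have r12 := rel i i' 1 2 hi (by decide)
    have r10 := rel i i' 1 0 hi (by decide)
    have r20 := rel i i' 2 0 hi (by decide)
    have r21 := rel i i' 2 1 hi (by decide)
    have s01 := anti 0 1 (by decide)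
    have s02 := anti 0 2 (by decide)
    have s12 := anti 1 2 (by decide)
    simp only [t]
    omega
  -- Three integers cannot have pairwise different parities.
  have t01 := odd_sub 0 1 (by decide)
  have t02 := odd_sub 0 2 (by decide)
  have t12 := odd_sub 1 2 (by decide)
  omega

/-! ### Restricting a graph to a set of vertices -/

namespace SimpleGraph

variable {V : Type*} {G : SimpleGraph V}

/-- The graph on all of `V` whose edges are the edges of `G` with both ends in `S`. -/
def restrictTo (G : SimpleGraph V) (S : Set V) : SimpleGraph V where
  Adj x y := G.Adj x y ∧ x ∈ S ∧ y ∈ S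
  symm := ⟨fun _ _ h ↦ ⟨h.1.symm, h.2.2, h.2.1⟩⟩
  loopless := ⟨fun _ h ↦ h.1.ne rfl⟩

lemma restrictTo_le (G : SimpleGraph V) (S : Set V) : G.restrictTo S ≤ G := fun _ _ h ↦ h.1

lemma restrictTo_mono {S T : Set V} (h : S ⊆ T) : G.restrictTo S ≤ G.restrictTo T :=
  fun _ _ k ↦ ⟨k.1, h k.2.1, h k.2.2⟩

lemma restrictTo_restrictTo (G : SimpleGraph V) (S T : Set V) :
    (G.restrictTo S).restrictTo T = G.restrictTo (S ∩ T) := by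
  ext x y
  simp only [restrictTo, Set.mem_inter_iff]
  tauto

/-- Any two vertices of `S` are joined by a walk of `G` inside `S`. -/
def PreconnectedOn (G : SimpleGraph V) (S : Set V) : Prop :=
  ∀ x ∈ S, ∀ y ∈ S, (G.restrictTo S).Reachable x y

/-! ### Plane drawings and K₃,₃ minors -/

/-- The part of the plane covered by the vertices and edges of the drawing inside `S`. -/
def PlaneDrawing.trace (d : G.PlaneDrawing) (S : Set V) : Set (EuclideanSpace ℝ (Fin 2)) :=
  {p | (∃ x ∈ S, p = d.point x) ∨ ∃ x ∈ S, ∃ y ∈ S, G.Adj x y ∧ p ∈ d.arc s(x, y)}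

/-- Arcs meet only at common end-vertices and contain no other vertices, so a common point would
produce a vertex in both sets. -/
lemma PlaneDrawing.disjoint_trace (d : G.PlaneDrawing) {S T : Set V} (h : Disjoint S T) :
    Disjoint (d.trace S) (d.trace T) := by
  have hne : ∀ x ∈ S, ∀ y ∈ T, x ≠ y := fun x hx y hy ↦ h.ne_of_mem hx hy
  rw [Set.disjoint_left]
  rintro p (⟨x, hx, rfl⟩ | ⟨x, hx, y, hy, hxy, hp⟩) (⟨u, hu, hpu⟩ | ⟨u, hu, v, hv, huv, hp'⟩)
  · exact hne x hx u hu (d.point_injective hpu)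
  · have := d.mem_of_point_mem_arc _ huv _ hp'
    rcases Sym2.mem_iff.1 this with rfl | rfl
    · exact hne _ hx _ hu rfl
    · exact hne _ hx _ hv rfl
  · subst hpu
    have := d.mem_of_point_mem_arc _ hxy _ hp
    rcases Sym2.mem_iff.1 this with rfl | rfl
    · exact hne _ hx _ hu rfl
    · exact hne _ hy _ hu rfl
  · have key : ∀ w, w ∈ s(x, y) → w ∈ s(u, v) → False := by
      intro w h1 h2
      have hS : w ∈ S := by rcases Sym2.mem_iff.1 h1 with rfl | rfl <;> assumption
      have hT : w ∈ T := by rcases Sym2.mem_iff.1 h2 with rfl | rfl <;> assumption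
      exact hne w hS w hT rfl
    have hef : s(x, y) ≠ s(u, v) := fun he ↦
      key x (Sym2.mem_mk_left _ _) (he ▸ Sym2.mem_mk_left _ _)
    obtain ⟨w, hw, -⟩ := d.arc_inter_arc _ hxy _ huv hef ⟨hp, hp'⟩
    exact key w hw.1 hw.2

lemma PlaneDrawing.exists_path (d : G.PlaneDrawing) {S : Set V} {x y : V} (hx : x ∈ S)
    (h : (G.restrictTo S).Reachable x y) :
    ∃ γ : _root_.Path (d.point x) (d.point y), Set.range γ ⊆ d.trace S := by
  rw [reachable_iff_reflTransGen] at h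
  induction h with
  | refl =>
    refine ⟨Path.refl _, ?_⟩
    rintro _ ⟨t, rfl⟩
    exact Or.inl ⟨x, hx, rfl⟩
  | tail _ hbc ih =>
    obtain ⟨γ, hγ⟩ := ih
    obtain ⟨η, -, hη⟩ := d.isArc _ _ hbc.1
    refine ⟨γ.trans η, ?_⟩
    rw [Path.trans_range, hη]
    exact Set.union_subset hγ fun p hp ↦ Or.inr ⟨_, hbc.2.1, _, hbc.2.2, hbc.1, hp⟩

/-- A planar graph has no `K₃,₃` minor. -/
theorem IsPlanar.not_K33_minor (hG : G.IsPlanar) (A B : Fin 3 → Set V)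
    (hA : ∀ i, G.PreconnectedOn (A i)) (hB : ∀ i, G.PreconnectedOn (B i))
    (hAA : ∀ i j, i ≠ j → Disjoint (A i) (A j)) (hBB : ∀ i j, i ≠ j → Disjoint (B i) (B j))
    (hAB : ∀ i j, Disjoint (A i) (B j))
    (hadj : ∀ i j, ∃ x ∈ A i, ∃ y ∈ B j, G.Adj x y) : False := by
  obtain ⟨d⟩ := hG
  have hAn : ∀ i, ∃ x, x ∈ A i := fun i ↦ by
    obtain ⟨x, hx, -⟩ := hadj i 0; exact ⟨x, hx⟩
  have hBn : ∀ j, ∃ x, x ∈ B j := fun j ↦ by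
    obtain ⟨-, -, y, hy, -⟩ := hadj 0 j; exact ⟨y, hy⟩
  choose a ha using hAn
  choose b hb using hBn
  have hpath : ∀ i j, ∃ γ : _root_.Path (d.point (a i)) (d.point (b j)),
      Set.range γ ⊆ d.trace (A i ∪ B j) := by
    intro i j
    obtain ⟨x, hx, y, hy, hxy⟩ := hadj i j
    refine d.exists_path (Or.inl (ha i)) ?_
    have h1 := (hA i _ (ha i) x hx).mono (restrictTo_mono (Set.subset_union_left (t := B j)))
    have h2 := (hB j y hy _ (hb j)).mono (restrictTo_mono (Set.subset_union_right (s := A i)))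
    have h3 : (G.restrictTo (A i ∪ B j)).Adj x y := ⟨hxy, Or.inl hx, Or.inr hy⟩
    exact (h1.trans h3.reachable).trans h2
  choose γ hγ using hpath
  let c : EuclideanSpace ℝ (Fin 2) → ℂ := fun p ↦ ⟨p 0, p 1⟩
  have hc : Continuous c := by
    have : c = fun p ↦ ((p 0 : ℝ) : ℂ) + (p 1 : ℝ) * Complex.I := by
      ext p; exact Complex.mk_eq_add_mul_I _ _
    rw [this]; fun_prop
  have hci : Function.Injective c := by
    intro p q h
    ext i
    fin_cases i
    · exact congrArg Complex.re h
    · exact congrArg Complex.im h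
  refine not_exists_K33_drawing (fun i ↦ c (d.point (a i))) (fun j ↦ c (d.point (b j)))
    (fun i j t ↦ c ((γ i j).extend t)) (fun i j ↦ hc.comp (γ i j).continuous_extend)
    (fun i j ↦ by simp) (fun i j ↦ by simp) ?_
  intro i j i' j' hi hj s t h
  have hdisj : Disjoint (A i ∪ B j) (A i' ∪ B j') := by
    rw [Set.disjoint_union_left, Set.disjoint_union_right, Set.disjoint_union_right]
    exact ⟨⟨hAA i i' hi, hAB i j'⟩, (hAB i' j).symm, hBB j j' hj⟩
  have hmem : ∀ i j t, (γ i j).extend t ∈ d.trace (A i ∪ B j) := fun i j t ↦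
    hγ i j (by rw [← Path.extend_range]; exact ⟨t, rfl⟩)
  exact Set.disjoint_left.1 (d.disjoint_trace hdisj) (hmem i j s) (hci h ▸ hmem i' j' t)

end SimpleGraph

namespace SimpleGraph

variable {V : Type*} {G : SimpleGraph V}

/-! ### Bounded distance -/

/-- The vertices `x` and `y` are at distance at most `n`. -/
def DistLE (G : SimpleGraph V) (n : ℕ) (x y : V) : Prop := G.edist x y ≤ n

lemma DistLE.refl (n : ℕ) (x : V) : G.DistLE n x x := by simp [DistLE]

lemma DistLE.symm {n : ℕ} {x y : V} (h : G.DistLE n x y) : G.DistLE n y x := by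
  rwa [DistLE, SimpleGraph.edist_comm]

lemma DistLE.mono {m n : ℕ} {x y : V} (h : G.DistLE m x y) (hmn : m ≤ n) : G.DistLE n x y :=
  le_trans (b := (m : ℕ∞)) h (by exact_mod_cast hmn)

lemma DistLE.trans {m n : ℕ} {x y z : V} (h : G.DistLE m x y) (h' : G.DistLE n y z) :
    G.DistLE (m + n) x z := by
  rw [DistLE]; push_cast
  exact SimpleGraph.edist_triangle.trans (add_le_add h h')

lemma DistLE.of_le {H : SimpleGraph V} (hle : H ≤ G) {n : ℕ} {x y : V} (h : H.DistLE n x y) :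
    G.DistLE n x y :=
  (edist_anti hle).trans h

lemma Adj.distLE {x y : V} (h : G.Adj x y) : G.DistLE 1 x y := by
  rw [DistLE, edist_eq_one_iff_adj.2 h]; rfl

lemma DistLE.exists_walk {n : ℕ} {x y : V} (h : G.DistLE n x y) :
    ∃ p : G.Walk x y, p.length ≤ n := by
  have hne : G.edist x y ≠ ⊤ := fun ht ↦ by simp [DistLE, ht] at h
  obtain ⟨p, hp⟩ := exists_walk_of_edist_ne_top hne
  exact ⟨p, by rw [DistLE, ← hp] at h; exact_mod_cast h⟩

lemma Walk.distLE {x y : V} (p : G.Walk x y) : G.DistLE p.length x y := edist_le p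

lemma DistLE.reachable {n : ℕ} {x y : V} (h : G.DistLE n x y) : G.Reachable x y :=
  let ⟨p, _⟩ := h.exists_walk
  ⟨p⟩

/-- If all vertices on shortest walks from `x` to `y` lie in `S`, restricting the graph to `S` does
not increase the distance. -/
lemma DistLE.restrictTo {S : Set V} {n : ℕ} {x y : V} (h : G.DistLE n x y)
    (hS : ∀ u i j, i + j ≤ n → G.DistLE i x u → G.DistLE j u y → u ∈ S) :
    (G.restrictTo S).DistLE n x y := by
  obtain ⟨p, hp⟩ := h.exists_walk
  clear h
  induction p generalizing n with
  | nil => exact .refl _ _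
  | @cons x x' y hadj q ih =>
    rw [Walk.length_cons] at hp
    have hx : x ∈ S := hS x 0 (q.length + 1) (by omega) (.refl _ _) (Walk.cons hadj q).distLE
    have hx' : x' ∈ S := hS x' 1 q.length (by omega) hadj.distLE q.distLE
    have h1 : (G.restrictTo S).Adj x x' := ⟨hadj, hx, hx'⟩
    have h2 := ih (n := n - 1) (fun u i j hij hu hj ↦
      hS u (1 + i) j (by omega) (hadj.distLE.trans hu) hj) (by omega)
    exact (h1.distLE.trans h2).mono (by omega)

/-! ### Breadth-first levels -/

/-- A chosen root of the connected component of `x`. -/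
noncomputable def root (G : SimpleGraph V) (x : V) : V := (G.connectedComponentMk x).out

/-- The distance of `x` to the root of its component. -/
noncomputable def level (G : SimpleGraph V) (x : V) : ℕ := G.dist (G.root x) x

lemma reachable_root (x : V) : G.Reachable (G.root x) x :=
  ConnectedComponent.exact (Quot.out_eq (G.connectedComponentMk x))

lemma Reachable.root_eq {x y : V} (h : G.Reachable x y) : G.root x = G.root y := by
  rw [root, root, ConnectedComponent.sound h]

lemma distLE_level (x : V) : G.DistLE (G.level x) (G.root x) x := by
  rw [DistLE, level, (reachable_root x).coe_dist_eq_edist]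

lemma level_root (x : V) : G.level (G.root x) = 0 := by
  rw [level, (reachable_root x).root_eq, dist_self]

lemma DistLE.level_le {n : ℕ} {x y : V} (h : G.DistLE n x y) : G.level y ≤ G.level x + n := by
  have h1 : G.DistLE (G.level x + n) (G.root y) y := by
    rw [← h.reachable.root_eq]; exact (distLE_level x).trans h
  rw [DistLE, ← (reachable_root y).coe_dist_eq_edist] at h1
  exact_mod_cast h1

lemma Reachable.distLE_level_add {x y : V} (h : G.Reachable x y) :
    G.DistLE (G.level x + G.level y) x y :=
  (distLE_level x).symm.trans (h.root_eq ▸ distLE_level y)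

/-- A vertex of positive level has a neighbour one level lower. -/
lemma exists_adj_level {x : V} (h : 0 < G.level x) :
    ∃ y, G.Adj x y ∧ G.level y + 1 = G.level x := by
  have hr : G.level (G.root x) = 0 := level_root x
  obtain ⟨p, hp⟩ := (distLE_level (G := G) x).symm.exists_walk
  revert p hr
  generalize G.root x = r
  intro hr p hp
  cases p with
  | nil => omega
  | @cons _ y _ hadj q =>
    refine ⟨y, hadj, ?_⟩
    rw [Walk.length_cons] at hp
    have h1 := q.distLE.symm.level_le
    have h2 := hadj.symm.distLE.level_le
    omega

/-- Vertices of level at least `t` on shortest walks from `x` to its root. -/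
def descentSet (G : SimpleGraph V) (x : V) (t : ℕ) : Set V :=
  {y | t ≤ G.level y ∧ ∃ n, n + G.level y ≤ G.level x ∧ G.DistLE n x y}

/-- Iterating `exists_adj_level` follows a geodesic towards the root; `descentSet` records the
bounds on level and distance along it. -/
lemma exists_descent {x : V} {t : ℕ} (h : t ≤ G.level x) :
    ∃ z ∈ G.descentSet x t, G.level z = t ∧ (G.restrictTo (G.descentSet x t)).Reachable x z := by
  obtain ⟨k, hk⟩ := Nat.exists_eq_add_of_le h
  induction k generalizing t with
  | zero => exact ⟨x, ⟨h, 0, by omega, .refl _ _⟩, by omega, .refl _⟩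
  | succ k ih =>
    obtain ⟨z, ⟨-, n, hn, hnz⟩, hz, hxz⟩ := ih (t := t + 1) (by omega) (by omega)
    obtain ⟨y, hzy, hy⟩ := exists_adj_level (G := G) (x := z) (by omega)
    have hsub : G.descentSet x (t + 1) ⊆ G.descentSet x t := fun u hu ↦ ⟨by have := hu.1; omega, hu.2⟩
    have hyD : y ∈ G.descentSet x t := ⟨by omega, n + 1, by omega, hnz.trans hzy.distLE⟩
    refine ⟨y, hyD, by omega, (hxz.mono (restrictTo_mono hsub)).trans ?_⟩
    exact Adj.reachable ⟨hzy, hsub ⟨hz.ge, n, hn, hnz⟩, hyD⟩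

/-- Balls about the root are connected, which makes them usable as branch sets of a minor. -/
lemma reachable_root_restrictTo {x : V} {m : ℕ} (h : G.level x < m) :
    (G.restrictTo {y | G.level y < m}).Reachable (G.root x) x := by
  obtain ⟨z, -, hz, hxz⟩ := exists_descent (G := G) (Nat.zero_le (G.level x))
  have hsub : G.descentSet x 0 ⊆ {y | G.level y < m} := by
    rintro y ⟨-, n, hn, -⟩
    simp only [Set.mem_ofPred_eq]; omega
  have hz' : z = G.root x := by
    have hr : G.Reachable x z := hxz.mono (restrictTo_le _ _)
    have := distLE_level (G := G) z
    rw [hz, DistLE, Nat.cast_zero, nonpos_iff_eq_zero, edist_eq_zero_iff] at this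
    rw [hr.root_eq, this]
  exact hz' ▸ (hxz.mono (restrictTo_mono hsub)).symm

/-! ### Components of vertex sets -/

/-- The vertices of `S` reachable from `c` inside `S`. -/
def componentIn (G : SimpleGraph V) (S : Set V) (c : V) : Set V :=
  {x | x ∈ S ∧ (G.restrictTo S).Reachable c x}

lemma componentIn_subset (S : Set V) (c : V) : G.componentIn S c ⊆ S := fun _ h ↦ h.1

lemma Reachable.restrictTo_componentIn {S : Set V} {c x : V}
    (h : (G.restrictTo S).Reachable c x) :
    (G.restrictTo (G.componentIn S c)).Reachable c x := by
  rw [reachable_iff_reflTransGen] at h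
  induction h with
  | refl => rfl
  | tail hab hbc ih =>
    rw [← reachable_iff_reflTransGen] at hab
    exact ih.trans (Adj.reachable
      ⟨hbc.1, ⟨hbc.2.1, hab⟩, ⟨hbc.2.2, hab.trans hbc.reachable⟩⟩)

lemma preconnectedOn_componentIn (S : Set V) (c : V) :
    G.PreconnectedOn (G.componentIn S c) := fun _ hx _ hy ↦
  (hx.2.restrictTo_componentIn).symm.trans (hy.2.restrictTo_componentIn)

lemma Reachable.mem_of_restrictTo {S : Set V} {x y : V} (hx : x ∈ S)
    (h : (G.restrictTo S).Reachable x y) : y ∈ S := by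
  rw [reachable_iff_reflTransGen] at h
  induction h with
  | refl => exact hx
  | tail _ h _ => exact h.2.2

/-- Along a walk the distance to `x` grows by at most one per step, so it cannot skip the value `n +
1`. -/
lemma exists_reachable_intermediate {S : Set V} {n : ℕ} {x y : V}
    (h : (G.restrictTo S).Reachable x y) (hxy : ¬ G.DistLE n x y) :
    ∃ z, (G.restrictTo S).Reachable x z ∧ ¬ G.DistLE n x z ∧ G.DistLE (n + 1) x z := by
  rw [reachable_iff_reflTransGen] at h
  induction h with
  | refl => exact (hxy (.refl _ _)).elim
  | @tail b c hab hbc ih =>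
    by_cases hb : G.DistLE n x b
    · rw [← reachable_iff_reflTransGen] at hab
      exact ⟨c, hab.trans hbc.reachable, hxy, hb.trans hbc.1.distLE⟩
    · exact ih hb

/-! ### Components of double annuli are bounded -/

/-- The annulus of levels in `[a - s, a + 2s)`. -/
def annulus (G : SimpleGraph V) (a s : ℕ) : Set V :=
  {x | a ≤ G.level x + s ∧ G.level x < a + 2 * s}

/-- The graph `G` restricted to an annulus. -/
def annulusGraph (G : SimpleGraph V) (a s : ℕ) : SimpleGraph V := G.restrictTo (G.annulus a s)

lemma annulusGraph_restrictTo (G : SimpleGraph V) (a s : ℕ) (T : Set V) :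
    (G.annulusGraph a s).restrictTo T = G.restrictTo (G.annulus a s ∩ T) :=
  restrictTo_restrictTo _ _ _

/-- The vertices of level in `[b, b + 3s)` with respect to the graph induced on an annulus. -/
def doubleAnnulus (G : SimpleGraph V) (a s b : ℕ) : Set V :=
  {x | x ∈ G.annulus a s ∧ b ≤ (G.annulusGraph a s).level x ∧
    (G.annulusGraph a s).level x < b + 3 * s}

/-- The part of the annulus just below a double annulus, near `p`. -/
def legRegion (G : SimpleGraph V) (a s b : ℕ) (p : V) : Set V :=
  {z | z ∈ G.annulus a s ∧ b ≤ (G.annulusGraph a s).level z + 9 * s ∧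
    (G.annulusGraph a s).level z < b ∧ G.DistLE (20 * s) p z}

/-- From a point of a double annulus there is a connected leg in the annulus which touches the
double annulus, the ball below it in the annulus, and the ball of the graph below the annulus. -/
lemma exists_leg {a s b : ℕ} (hs : 0 < s) (ha : s < a) (hb : 10 * s ≤ b) {p : V}
    (hp : p ∈ G.doubleAnnulus a s b) :
    ∃ c ∈ G.legRegion a s b p,
      (∃ x, (G.restrictTo (G.doubleAnnulus a s b)).Reachable p x ∧
        ∃ y ∈ G.componentIn (G.legRegion a s b p) c, G.Adj x y) ∧
      (∃ x ∈ G.annulus a s, (G.annulusGraph a s).level x < b - 9 * s ∧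
        (G.annulusGraph a s).Reachable p x ∧
        ∃ y ∈ G.componentIn (G.legRegion a s b p) c, G.Adj x y) ∧
      (∃ x, G.level x < a - s ∧ G.Reachable p x ∧
        ∃ y ∈ G.componentIn (G.legRegion a s b p) c, G.Adj x y) := by
  have hHG : (G.annulusGraph a s) ≤ G := restrictTo_le _ _
  obtain ⟨hpS, hpb, hpb'⟩ := hp
  have hmemS : ∀ {x y : V}, x ∈ G.annulus a s → (G.annulusGraph a s).Reachable x y →
      y ∈ G.annulus a s := fun hx h ↦ h.mem_of_restrictTo hx
  obtain ⟨p', ⟨-, n₁, hn₁, hpp'⟩, hp'b, hreach₁⟩ := exists_descent (G := G.annulusGraph a s) hpb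
  obtain ⟨q, hp'q, hq⟩ := exists_adj_level (G := G.annulusGraph a s) (x := p') (by omega)
  -- The branching point `c` sits `4 * s` below `b`: the descent in `G` from `c` has length below `3
  -- * s`, so its H-levels stay within `[b - 9 * s, b)`.
  obtain ⟨c, ⟨-, n₂, hn₂, hqc⟩, hcb, hreach₂⟩ :=
    exists_descent (G := G.annulusGraph a s) (x := q) (t := b - 4 * s) (by omega)
  obtain ⟨z, ⟨-, n₃, hn₃, hcz⟩, hzb, hreach₃⟩ :=
    exists_descent (G := G.annulusGraph a s) (x := c) (t := b - 9 * s) (by omega)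
  obtain ⟨z', hzz', hz'⟩ := exists_adj_level (G := G.annulusGraph a s) (x := z) (by omega)
  have hqS := hp'q.2.2
  have hcS := hmemS hqS hqc.reachable
  have hpq : (G.annulusGraph a s).DistLE (3 * s) p q := (hpp'.trans hp'q.distLE).mono (by omega)
  have hpc : (G.annulusGraph a s).DistLE (7 * s) p c := (hpq.trans hqc).mono (by omega)
  have hcT : c ∈ G.legRegion a s b p :=
    ⟨hcS, by omega, by omega, (hpc.of_le hHG).mono (by omega)⟩
  have hc₁ : a ≤ G.level c + s := hcS.1
  have hc₂ : G.level c < a + 2 * s := hcS.2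
  obtain ⟨w, hwD, hw, hreach₄⟩ := exists_descent (G := G) (x := c) (t := a - s) (by omega)
  obtain ⟨w', hww', hw'⟩ := exists_adj_level (G := G) (x := w) (by omega)
  have sub₂ : G.annulus a s ∩ (G.annulusGraph a s).descentSet q (b - 4 * s) ⊆ G.legRegion a s b p := by
    rintro u ⟨huS, hu, n, hn, hqu⟩
    exact ⟨huS, by omega, by omega, ((hpq.trans hqu).of_le hHG).mono (by omega)⟩
  have sub₃ : G.annulus a s ∩ (G.annulusGraph a s).descentSet c (b - 9 * s) ⊆ G.legRegion a s b p := by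
    rintro u ⟨huS, hu, n, hn, hcu⟩
    exact ⟨huS, by omega, by omega, ((hpc.trans hcu).of_le hHG).mono (by omega)⟩
  have sub₄ : G.descentSet c (a - s) ⊆ G.legRegion a s b p := by
    rintro u ⟨hu, n, hn, hcu⟩
    -- Geodesics of this descent have levels between those of `u` and `c`, so they stay in the
    -- annulus and also measure distance in H.
    have hHu : (G.annulusGraph a s).DistLE n c u := hcu.restrictTo fun v i j hij hv hv' ↦ by
      have h1 := hv.symm.level_le
      have h2 := hv'.symm.level_le
      exact ⟨by omega, by omega⟩
    have h1 := hHu.level_le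
    have h2 := hHu.symm.level_le
    exact ⟨⟨by omega, by omega⟩, by omega, by omega,
      ((hpc.trans hHu).of_le hHG).mono (by omega)⟩
  rw [annulusGraph_restrictTo] at hreach₂ hreach₃
  have hqc' := hreach₂.mono (restrictTo_mono sub₂)
  have hcz' := hreach₃.mono (restrictTo_mono sub₃)
  have hcw' := hreach₄.mono (restrictTo_mono sub₄)
  refine ⟨c, hcT, ⟨p', ?_, q, ⟨?_, hqc'.symm⟩, hp'q.1⟩,
    ⟨z', hzz'.2.2, by omega, ?_, z, ⟨hcz'.mem_of_restrictTo hcT, hcz'⟩, hzz'.1.symm⟩,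
    ⟨w', by omega, ?_, w, ⟨hcw'.mem_of_restrictTo hcT, hcw'⟩, hww'.symm⟩⟩
  · rw [annulusGraph_restrictTo] at hreach₁
    refine hreach₁.mono (restrictTo_mono ?_)
    rintro u ⟨huS, hu, n, hn, -⟩
    exact ⟨huS, hu, by omega⟩
  · exact hqc'.symm.mem_of_restrictTo hcT
  · exact (hpc.trans hcz).reachable.trans hzz'.reachable
  · exact ((hpc.of_le hHG).reachable.trans (hreach₄.mono (restrictTo_le _ _))).trans hww'.reachable

/-- Three points at pairwise distance above `40 * s` have disjoint legs, since each leg lies within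
`20 * s` of its point. Each leg is adjacent to the same three hubs, which is a K₃,₃ minor. -/
theorem IsPlanar.distLE_of_reachable_doubleAnnulus (hG : G.IsPlanar) {a s b : ℕ} (hs : 0 < s)
    {x y : V} (hx : x ∈ G.doubleAnnulus a s b)
    (h : (G.restrictTo (G.doubleAnnulus a s b)).Reachable x y) : G.DistLE (81 * s) x y := by
  have hy := h.mem_of_restrictTo hx
  have hHG : G.annulusGraph a s ≤ G := restrictTo_le _ _
  have hKH : G.restrictTo (G.doubleAnnulus a s b) ≤ G.annulusGraph a s :=
    restrictTo_mono fun u hu ↦ hu.1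
  -- If the annulus or the double annulus is close to its root, travelling through the root is short
  -- enough. Otherwise both lower balls contain their roots.
  rcases Nat.lt_or_ge s a with ha | ha
  swap
  · have hx1 := hx.1.2
    have hy1 := hy.1.2
    exact (h.mono (hKH.trans hHG)).distLE_level_add.mono (by omega)
  rcases Nat.lt_or_ge b (10 * s) with hb | hb
  · have hx1 := hx.2.2
    have hy1 := hy.2.2
    exact ((h.mono hKH).distLE_level_add.of_le hHG).mono (by omega)
  by_contra hfar
  -- `m` is at distance `40 * s + 1` from `x`; as `(40 * s + 1) + 40 * s ≤ 81 * s`, it is also far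
  -- from `y`.
  obtain ⟨m, hxm, hm, hm'⟩ := exists_reachable_intermediate (n := 40 * s) h
    (fun h ↦ hfar (h.mono (by omega)))
  have hmy : ¬ G.DistLE (40 * s) m y := fun h ↦ hfar ((hm'.trans h).mono (by omega))
  have hxy : ¬ G.DistLE (40 * s) x y := fun h ↦ hfar (h.mono (by omega))
  let p : Fin 3 → V := ![x, m, y]
  have hpK : ∀ i, (G.restrictTo (G.doubleAnnulus a s b)).Reachable x (p i) := by
    intro i; fin_cases i
    · exact .refl _
    · exact hxm
    · exact h
  have hpp : ∀ i j, i ≠ j → ¬ G.DistLE (40 * s) (p i) (p j) := by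
    intro i j hij
    fin_cases i <;> fin_cases j <;> first | exact (hij rfl).elim | skip
    · exact hm
    · exact hxy
    · exact fun h ↦ hm h.symm
    · exact hmy
    · exact fun h ↦ hxy h.symm
    · exact fun h ↦ hmy h.symm
  have hleg := fun i ↦ exists_leg (G := G) hs ha hb ((hpK i).mem_of_restrictTo hx)
  choose c hc hup hdown hout using hleg
  let low : Set V := {u | u ∈ G.annulus a s ∧ (G.annulusGraph a s).level u < b - 9 * s}
  let ball : Set V := {u | G.level u < a - s}
  let A : Fin 3 → Set V := ![G.componentIn (G.doubleAnnulus a s b) x,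
    G.componentIn low ((G.annulusGraph a s).root x), G.componentIn ball (G.root x)]
  have hrootS : (G.annulusGraph a s).root x ∈ G.annulus a s :=
    Reachable.mem_of_restrictTo hx.1 (reachable_root (G := G.annulusGraph a s) x).symm
  have hrootlow : (G.annulusGraph a s).root x ∈ low := ⟨hrootS, by rw [level_root]; omega⟩
  have hrootball : G.root x ∈ ball := by
    simp only [ball, Set.mem_ofPred_eq, level_root]; omega
  have d01 : Disjoint (G.doubleAnnulus a s b) low := Set.disjoint_left.2 fun u hu hu' ↦ by
    have h1 := hu.2.1
    have h2 : (G.annulusGraph a s).level u < b - 9 * s := hu'.2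
    omega
  have dS : Disjoint (G.annulus a s) ball := Set.disjoint_left.2 fun u hu hu' ↦ by
    have h1 := hu.1
    have h2 : G.level u < a - s := hu'
    omega
  have d02 : Disjoint (G.doubleAnnulus a s b) ball := dS.mono_left fun u hu ↦ hu.1
  have d12 : Disjoint low ball := dS.mono_left fun u hu ↦ hu.1
  refine hG.not_K33_minor A (fun i ↦ G.componentIn (G.legRegion a s b (p i)) (c i)) ?_
    (fun i ↦ preconnectedOn_componentIn _ _) ?_ ?_ ?_ ?_
  · intro i; fin_cases i
    · exact preconnectedOn_componentIn _ _
    · exact preconnectedOn_componentIn _ _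
    · exact preconnectedOn_componentIn _ _
  · have k01 := d01.mono (componentIn_subset (G := G) _ x) (componentIn_subset (G := G) _ ((G.annulusGraph a s).root x))
    have k02 := d02.mono (componentIn_subset (G := G) _ x) (componentIn_subset (G := G) _ (G.root x))
    have k12 := d12.mono (componentIn_subset (G := G) _ ((G.annulusGraph a s).root x))
      (componentIn_subset (G := G) _ (G.root x))
    intro i j hij
    fin_cases i <;> fin_cases j <;> first | exact (hij rfl).elim | skip
    · exact k01
    · exact k02
    · exact k01.symm
    · exact k12
    · exact k02.symm
    · exact k12.symm
  · intro i j hij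
    refine Set.disjoint_left.2 fun u hu hu' ↦ hpp i j hij ?_
    exact (hu.1.2.2.2.trans hu'.1.2.2.2.symm).mono (by omega)
  · intro i j
    have hT : ∀ u ∈ G.componentIn (G.legRegion a s b (p j)) (c j),
      u ∈ G.annulus a s ∧ b ≤ (G.annulusGraph a s).level u + 9 * s ∧ (G.annulusGraph a s).level u < b := fun u hu ↦
        ⟨hu.1.1, hu.1.2.1, hu.1.2.2.1⟩
    refine Set.disjoint_right.2 fun u hu ↦ ?_
    obtain ⟨h1, h2, h3⟩ := hT u hu
    fin_cases i
    · exact fun hu' ↦ absurd hu'.1.2.1 (not_le.2 h3)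
    · intro hu'
      have : (G.annulusGraph a s).level u < b - 9 * s := hu'.1.2
      omega
    · exact fun hu' ↦ Set.disjoint_left.1 dS h1 hu'.1
  · intro i j
    have hK := hpK j
    fin_cases i
    · obtain ⟨u, hu, v, hv, huv⟩ := hup j
      exact ⟨u, ⟨(hK.trans hu).mem_of_restrictTo hx, hK.trans hu⟩, v, hv, huv⟩
    · obtain ⟨u, huS, hub, hu, v, hv, huv⟩ := hdown j
      have hr : (G.annulusGraph a s).root u = (G.annulusGraph a s).root x := ((hK.mono hKH).trans hu).root_eq.symm
      have := reachable_root_restrictTo (G := G.annulusGraph a s) hub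
      rw [hr, annulusGraph_restrictTo] at this
      exact ⟨u, ⟨⟨huS, hub⟩, this⟩, v, hv, huv⟩
    · obtain ⟨u, hub, hu, v, hv, huv⟩ := hout j
      have hr : G.root u = G.root x := ((hK.mono (hKH.trans hHG)).trans hu).root_eq.symm
      have := reachable_root_restrictTo hub
      rw [hr] at this
      exact ⟨u, ⟨hub, this⟩, v, hv, huv⟩

end SimpleGraph

namespace SimpleGraph

variable {V : Type*} {G : SimpleGraph V}

/-! ### Colourings with bounded monochromatic chains -/

/-- Splitting an annulus of width `s` into layers of width `s` of the breadth-first levels of the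
annulus graph, and colouring the layers alternately, all monochromatic chains are bounded. -/
theorem IsPlanar.distLE_of_chain_annulus (hG : G.IsPlanar) {a s : ℕ} (hs : 0 < s) {x y : V}
    (h : Relation.ReflTransGen (fun u v ↦ (a ≤ G.level u ∧ G.level u < a + s) ∧
      (a ≤ G.level v ∧ G.level v < a + s) ∧
      ((G.annulusGraph a s).level u / s) % 2 = ((G.annulusGraph a s).level v / s) % 2 ∧
      G.DistLE s u v) x y) : G.DistLE (81 * s) x y := by
  rcases h.cases_head with rfl | ⟨_, ⟨hx, -⟩, -⟩
  · exact .refl _ _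
  set k := (G.annulusGraph a s).level x / s with hk
  have hlayer : ∀ u, (G.annulusGraph a s).level u / s = k →
      k * s ≤ (G.annulusGraph a s).level u ∧ (G.annulusGraph a s).level u < k * s + s := by
    intro u hu
    have h1 := Nat.div_mul_le_self ((G.annulusGraph a s).level u) s
    have h2 := Nat.lt_div_mul_add (a := (G.annulusGraph a s).level u) hs
    rw [hu] at h1 h2
    exact ⟨h1, h2⟩
  have hxl := hlayer x hk.symm
  -- Layer `k` is enlarged by `s` on both sides. For `k = 0` the truncated subtraction gives the
  -- levels below `3 * s`, which still suffices.
  refine hG.distLE_of_reachable_doubleAnnulus (a := a) (b := k * s - s) hs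
    ⟨⟨by omega, by omega⟩, by omega, by omega⟩ ?_
  suffices (G.annulusGraph a s).level y / s = k ∧
    (G.restrictTo (G.doubleAnnulus a s (k * s - s))).Reachable x y from this.2
  induction h with
  | refl => exact ⟨rfl, .refl _⟩
  | @tail u v _ huv ih =>
    obtain ⟨hu, hv, hpar, huv⟩ := huv
    obtain ⟨hku, hxu⟩ := ih
    have hH : (G.annulusGraph a s).DistLE s u v := huv.restrictTo fun w i j hij hi hj ↦ by
      have h1 := hi.level_le
      have h2 := hi.symm.level_le
      exact ⟨by omega, by omega⟩
    -- A step changes the layer index by at most one, and equal parity forbids a change by one.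
    have hkv : (G.annulusGraph a s).level v / s = k := by
      have h1 := Nat.div_le_div_right (c := s) hH.level_le
      have h2 := Nat.div_le_div_right (c := s) hH.symm.level_le
      rw [Nat.add_div_right _ hs] at h1 h2
      omega
    refine ⟨hkv, hxu.trans ?_⟩
    have hul := hlayer u hku
    have hK := hH.restrictTo (S := {w | k * s - s ≤ (G.annulusGraph a s).level w ∧
        (G.annulusGraph a s).level w < k * s - s + 3 * s}) fun w i j hij hi hj ↦ by
      have h1 := hi.level_le
      have h2 := hi.symm.level_le
      exact ⟨by omega, by omega⟩
    rw [annulusGraph_restrictTo] at hK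
    exact hK.reachable

/-- Two families of bounded chains, the second one at a scale larger than the size of the chains of
the first, combine to bounded chains. -/
lemma distLE_of_chain_merge {r D D' : ℕ} {β : V → ℕ} {E : V → Prop}
    (hE : ∀ x y, Relation.ReflTransGen
      (fun u v ↦ E u ∧ E v ∧ β u = β v ∧ G.DistLE r u v) x y → G.DistLE D x y)
    (hO : ∀ x y, Relation.ReflTransGen
      (fun u v ↦ ¬ E u ∧ ¬ E v ∧ β u = β v ∧ G.DistLE (D + 2 * r) u v) x y → G.DistLE D' x y)
    {x y : V} (h : Relation.ReflTransGen (fun u v ↦ β u = β v ∧ G.DistLE r u v) x y) :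
    G.DistLE (D' + 2 * (D + r)) x y := by
  -- Invariant: each excursion into `E` between two points outside `E` is replaced by one jump of
  -- length at most `r + D + r`. Only the initial and the final excursion remain, costing `D + r`
  -- each.
  have key : (E y ∧ Relation.ReflTransGen
        (fun u v ↦ E u ∧ E v ∧ β u = β v ∧ G.DistLE r u v) x y) ∨
      ∃ u w, ¬ E w ∧ β w = β y ∧ G.DistLE (D + r) x u ∧ Relation.ReflTransGen
        (fun u v ↦ ¬ E u ∧ ¬ E v ∧ β u = β v ∧ G.DistLE (D + 2 * r) u v) u w ∧
        (w = y ∨ ∃ z, E y ∧ G.DistLE r w z ∧ Relation.ReflTransGen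
          (fun u v ↦ E u ∧ E v ∧ β u = β v ∧ G.DistLE r u v) z y) := by
    induction h with
    | refl =>
      by_cases hx : E x
      · exact Or.inl ⟨hx, .refl⟩
      · exact Or.inr ⟨x, x, hx, rfl, .refl _ _, .refl, Or.inl rfl⟩
    | @tail y y' _ hyy' ih =>
      obtain ⟨hβ, hd⟩ := hyy'
      by_cases hy' : E y'
      · rcases ih with ⟨hy, ih⟩ | ⟨u, w, hw, hwy, hxu, huw, rfl | ⟨z, hy, hwz, hzy⟩⟩
        · exact Or.inl ⟨hy', ih.tail ⟨hy, hy', hβ, hd⟩⟩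
        · exact Or.inr ⟨u, w, hw, hβ, hxu, huw, Or.inr ⟨y', hy', hd, .refl⟩⟩
        · exact Or.inr ⟨u, w, hw, hwy.trans hβ, hxu, huw,
            Or.inr ⟨z, hy', hwz, hzy.tail ⟨hy, hy', hβ, hd⟩⟩⟩
      · rcases ih with ⟨hy, ih⟩ | ⟨u, w, hw, hwy, hxu, huw, rfl | ⟨z, hy, hwz, hzy⟩⟩
        · exact Or.inr ⟨y', y', hy', rfl, (hE _ _ ih).trans hd, .refl, Or.inl rfl⟩
        · exact Or.inr ⟨u, y', hy', rfl, hxu, huw.tail ⟨hw, hy', hβ, hd.mono (by omega)⟩,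
            Or.inl rfl⟩
        · exact Or.inr ⟨u, y', hy', rfl, hxu, huw.tail ⟨hw, hy', hwy.trans hβ,
            ((hwz.trans (hE _ _ hzy)).trans hd).mono (by omega)⟩, Or.inl rfl⟩
  rcases key with ⟨-, h⟩ | ⟨u, w, -, -, hxu, huw, rfl | ⟨z, -, hwz, hzy⟩⟩
  · exact (hE _ _ h).mono (by omega)
  · exact (hxu.trans (hO _ _ huw)).mono (by omega)
  · exact ((hxu.trans (hO _ _ huw)).trans (hwz.trans (hE _ _ hzy))).mono (by omega)

/-- The vertices of a planar graph have a colouring with three colours in which all monochromatic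
chains with steps of length at most `r` have diameter linear in `r`. -/
theorem IsPlanar.exists_coloring (hG : G.IsPlanar) (r : ℕ) : ∃ col : V → Fin 3, ∀ x y,
    Relation.ReflTransGen (fun u v ↦ col u = col v ∧ G.DistLE r u v) x y →
      G.DistLE (6887 * r) x y := by
  rcases Nat.eq_zero_or_pos r with rfl | hr
  · refine ⟨fun _ ↦ 0, fun x y h ↦ ?_⟩
    induction h with
    | refl => exact .refl _ _
    | tail _ h ih => exact ih.trans h.2
  -- Even rings have chains of size `81 * r`; bridging one with a step at each end costs `83 * r`,
  -- the scale of the odd rings.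
  let scale : ℕ → ℕ := fun j ↦ if j % 2 = 0 then r else 83 * r
  let ring : V → ℕ := fun x ↦ G.level x / r
  let c : V → ℕ := fun x ↦
    ((G.annulusGraph (ring x * r) (scale (ring x))).level x / scale (ring x)) % 2
  have hc : ∀ x, c x < 2 := fun x ↦ Nat.mod_lt _ (by norm_num)
  let β : V → ℕ := fun x ↦ ring x + c x
  have hring : ∀ x, ring x * r ≤ G.level x ∧ G.level x < ring x * r + r := fun x ↦
    ⟨Nat.div_mul_le_self _ _, Nat.lt_div_mul_add hr⟩
  have bounded : ∀ e s, r ≤ s → (∀ j, j % 2 = e → scale j = s) → ∀ x y,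
      Relation.ReflTransGen (fun u v ↦ ring u % 2 = e ∧ ring v % 2 = e ∧ β u = β v ∧
        G.DistLE s u v) x y → G.DistLE (81 * s) x y := by
    intro e s hs hscale x y h
    refine hG.distLE_of_chain_annulus (a := ring x * r) (s := s) (by omega) ?_
    suffices ring y = ring x ∧ _ from this.2
    induction h with
    | refl => exact ⟨rfl, .refl⟩
    | @tail u v _ huv ih =>
      obtain ⟨hu, hv, hβ, hd⟩ := huv
      have h1 := hc u
      have h2 := hc v
      simp only [β] at hβ
      -- Equal `β` forces the rings to differ by at most one, and equal parity then makes them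
      -- equal, whatever the step length.
      have huv : ring v = ring u := by omega
      refine ⟨huv.trans ih.1, ih.2.tail ?_⟩
      have hcc : c u = c v := by omega
      simp only [c, huv, hscale _ hu] at hcc
      have h3 := hring u
      have h4 := hring v
      rw [huv] at h4
      rw [ih.1] at hcc h3 h4
      exact ⟨⟨h3.1, by omega⟩, ⟨h4.1, by omega⟩, hcc, hd⟩
  refine ⟨fun x ↦ ⟨β x % 3, Nat.mod_lt _ (by norm_num)⟩, fun x y h ↦ ?_⟩
  have h' : Relation.ReflTransGen (fun u v ↦ β u = β v ∧ G.DistLE r u v) x y := by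
    refine Relation.ReflTransGen.mono (fun u v huv ↦ ⟨?_, huv.2⟩) _ _ h
    -- A step of length `r` changes `ring` and `c` by at most one each, hence `β` by at most two, so
    -- `β` is determined by its residue modulo 3.
    have h0 : β u % 3 = β v % 3 := congrArg Fin.val huv.1
    have h1 := Nat.div_le_div_right (c := r) huv.2.level_le
    have h2 := Nat.div_le_div_right (c := r) huv.2.symm.level_le
    rw [Nat.add_div_right _ hr] at h1 h2
    have h3 := hc u
    have h4 := hc v
    simp only [β, ring] at h0 ⊢
    omega
  -- The constant is `81 * 83 + 2 * (81 + 1) = 6887`.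
  refine (distLE_of_chain_merge (E := fun x ↦ ring x % 2 = 0) (D := 81 * r)
    (D' := 81 * (83 * r)) (bounded 0 r le_rfl fun j hj ↦ by simp [scale, hj]) ?_ h').mono
    (by omega)
  intro u v huv
  refine bounded 1 (83 * r) (by omega) (fun j hj ↦ by simp [scale, hj]) u v
    (Relation.ReflTransGen.mono (fun p q hpq ↦ ?_) _ _ huv)
  exact ⟨by have := hpq.1; omega, by have := hpq.2.1; omega, hpq.2.2.1,
    hpq.2.2.2.mono (by omega)⟩

end SimpleGraph

/-! ### From colourings to the dimension -/

/-- Planar graphs have Assouad–Nagata dimension at most two; the degree bound is not needed. -/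
theorem mainTheorem5 {V : Type*} (G : SimpleGraph V) (hG : G.IsPlanar)
    (hdeg : G.HasBoundedDegree) : G.assouadNagataDim ≤ 2 := by
  let _ := G.pathEMetricSpace
  have hedist : ∀ x y : V, ∀ n : ℕ, edist x y ≤ (n : ℝ≥0∞) ↔ G.DistLE n x y := by
    intro x y n
    change (G.edist x y : ℝ≥0∞) ≤ n ↔ _
    rw [← ENat.toENNReal_coe, ENat.toENNReal_le]
    rfl
  -- Finite graph distances are integers, so only the integer part of `r` matters.
  refine iInf₂_le_of_le 2 ⟨fun r ↦ 6887 * ⌊r⌋₊, ?_, 6887, by norm_num, fun r _ ↦ ?_⟩ le_rfl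
  swap
  · exact mul_le_mul_right (Nat.floor_le zero_le) _
  intro r _
  obtain ⟨col, hcol⟩ := hG.exists_coloring ⌊r⌋₊
  let step : V → V → Prop := fun u v ↦ col u = col v ∧ G.DistLE ⌊r⌋₊ u v
  have : Std.Symm step := ⟨fun u v h ↦ ⟨h.1.symm, h.2.symm⟩⟩
  have hchain : ∀ {u v}, Relation.ReflTransGen step u v → Relation.ReflTransGen step v u :=
    fun h ↦ Relation.ReflTransGen.stdSymm.symm _ _ h
  have hcolor : ∀ u v, Relation.ReflTransGen step u v → col u = col v := by
    intro u v h
    induction h with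
    | refl => rfl
    | tail _ h ih => exact ih.trans h.1
  refine ⟨fun i ↦ {U | ∃ x, col x = i ∧ U = {y | Relation.ReflTransGen step x y}}, ?_,
    fun i ↦ ⟨?_, ?_⟩⟩
  · refine Set.eq_univ_of_forall fun x ↦ Set.mem_iUnion.2 ⟨col x, ?_⟩
    exact Set.mem_sUnion.2 ⟨_, ⟨x, rfl, rfl⟩, .refl⟩
  · rintro _ ⟨x, hx, rfl⟩ _ ⟨y, hy, rfl⟩ hne u hu v hv
    by_contra! hlt
    refine hne ?_
    -- Points of equal colour at distance at most `r` form a step, so their chain classes coincide.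
    have huv : step u v := by
      refine ⟨by rw [← hcolor x u hu, ← hcolor y v hv, hx, hy], ?_⟩
      obtain ⟨n, hn⟩ : ∃ n : ℕ, G.edist u v = n := by
        refine ENat.ne_top_iff_exists.1 (fun htop ↦ ?_) |>.imp fun _ h ↦ h.symm
        change (G.edist u v : ℝ≥0∞) ≤ r at hlt
        simp [htop] at hlt
      have hle : (n : ℝ≥0∞) ≤ r := by
        change (G.edist u v : ℝ≥0∞) ≤ r at hlt
        simpa [hn] using hlt
      have : (n : ℝ≥0) ≤ r := by exact_mod_cast hle
      rw [SimpleGraph.DistLE, hn]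
      exact_mod_cast Nat.le_floor this
    have hxy : Relation.ReflTransGen step x y := (hu.tail huv).trans (hchain hv)
    ext z
    exact ⟨fun hz ↦ (hchain hxy).trans hz, fun hz ↦ hxy.trans hz⟩
  · rintro _ ⟨x, hx, rfl⟩
    refine Metric.ediam_le fun u hu v hv ↦ ?_
    have := (hedist u v _).2 (hcol u v ((hchain hu).trans hv))
    simpa using this
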